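/- Let $\mathfrak D_{2n}$ ($n\ge 0$) be the set of D-permutations of $[2n]$, i.e. permutations $\sigma$ with $\sigma(i)\ge i$ for every odd $i$ and $\sigma(i)\le i$ for every even $i$. Let $\mathrm{evenfix}(\sigma)$ and $\mathrm{oddfix}(\sigma)$ be the numbers of even and odd fixed points of $\sigma$. A labelled 0-Schröder path of length $2n$ is a pair $(\omega,\xi)$, where $\omega$ is a lattice path from $(0,0)$ to $(2n,0)$ that never goes below height $0$, with steps $(1,1)$ (rise), $(1,-1)$ (fall) and $(2,0)$ (long level step, allowed at height $0$ only), and where step $s_i$ (the step starting at abscissa $i-1$), if its starting height is $h$, carries a label $\xi_i\in\{0,\dots,\lceil h/2\rceil\}$ if it is a rise, $\xi_i\in\{0,\dots,\lceil (h-1)/2\rceil\}$ if it is a fall, and $\xi_i=0$ if it is a long level step. Let $\mathfrak{DS}_{2n}$ be the set of these labelled paths. The Deb–Sokal map $\varphi_{2n}$ sends $\sigma\in\mathfrak D_{2n}$ to the following labelled path. Take the path from $(0,0)$ whose $i$-th step is a rise if $\sigma^{-1}(i)$ is even and a fall if $\sigma^{-1}(i)$ is odd, and replace each fall from height $0$ together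 with the rise from height $-1$ that follows it by one long level step with label $0$. Every other step $i$ gets the label $\xi_i=\#\{j:\sigma(j)<\sigma(i)\le i<j\}$ if $i$ is even and $\xi_i=\#\{j: j<i\le\sigma(i)<\sigma(j)\}$ if $i$ is odd. Let $\phi_{2n}(\omega,\xi)=(\omega,\xi^{\mathrm c})$ where, for a step $s_i$ with starting height $h$: if $s_i$ is a rise and $i$ is odd, $\xi_i^{\mathrm c}=\lceil h/2\rceil-\xi_i$; if $s_i$ is a rise and $i$ is even, $\xi_i^{\mathrm c}=\lceil h/2\rceil-1-\xi_i$ when $\xi_i<\lceil h/2\rceil$ and $\xi_i^{\mathrm c}=\xi_i$ when $\xi_i=\lceil h/2\rceil$; if $s_i$ is a fall and $i$ is even, $\xi_i^{\mathrm c}=\lceil (h-1)/2\rceil-\xi_i$; if $s_i$ is a fall and $i$ is odd, $\xi_i^{\mathrm c}=\lceil (h-1)/2\rceil-1-\xi_i$ when $\xi_i<\lceil (h-1)/2\rceil$ and $\xi_i^{\mathrm c}=\xi_i$ when $\xi_i=\lceil (h-1)/2\rceil$; if $s_i$ is a long level step, $\xi_i^{\mathrm c}=\xi_i=0$. Then: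 1. For every $n\ge0$, $\varphi_{2n}$ is a bijection from $\mathfrak D_{2n}$ onto $\mathfrak{DS}_{2n}$. 2. For every $n\ge0$, $\phi_{2n}$ is an involution on $\mathfrak{DS}_{2n}$, and $(\omega,\xi)\in\mathfrak{DS}_{2n}$ is fixed by $\phi_{2n}$ if and only if $\omega$ does not go above height $2$. 3. For every $n\ge0$, the Genocchi–Corteel map $\phi^{\mathrm{GC}}_{2n}=\varphi_{2n}^{-1}\circ\phi_{2n}\circ\varphi_{2n}$ is an involution on $\mathfrak D_{2n}$. 4. Let $$P_n(w_{\mathrm e},w_{\mathrm o})=\sum_{\sigma\in\mathfrak D_{2n},\ \phi^{\mathrm{GC}}_{2n}(\sigma)=\sigma} w_{\mathrm e}^{\mathrm{evenfix}(\sigma)}\,w_{\mathrm o}^{\mathrm{oddfix}(\sigma)}.$$ Then, as formal power series in $t$ over $\mathbb Z[w_{\mathrm e},w_{\mathrm o}]$, $$\sum_{n=0}^\infty P_n(w_{\mathrm e},w_{\mathrm o})\,t^n=\dfrac{1}{1-w_{\mathrm e}w_{\mathrm o}t-\dfrac{t}{1-(1+w_{\mathrm e})(1+w_{\mathrm o})t}}.$$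 -/

import Mathlib

open scoped PowerSeries

namespace GenocchiCorteel

/-! ### D-permutations

A permutation of `[2n] = {1, …, 2n}` is an `Equiv.Perm (Fin (2 * n))`; the element `i : Fin (2 * n)`
stands for the letter `i + 1`. -/

/-- A D-permutation of `[2n]`: every odd letter satisfies `i ≤ σ(i)` and every even letter satisfies
`σ(i) ≤ i`. -/
def IsDPerm {n : ℕ} (σ : Equiv.Perm (Fin (2 * n))) : Prop :=
  ∀ i : Fin (2 * n), (Odd ((i : ℕ) + 1) → i ≤ σ i) ∧ (Even ((i : ℕ) + 1) → σ i ≤ i)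

/-- The set of D-permutations of `[2n]`. -/
def DPerms (n : ℕ) : Set (Equiv.Perm (Fin (2 * n))) := {σ | IsDPerm σ}

/-- The number of even fixed points. -/
def evenFix {n : ℕ} (σ : Equiv.Perm (Fin (2 * n))) : ℕ :=
  (Finset.univ.filter fun i : Fin (2 * n) => Even ((i : ℕ) + 1) ∧ σ i = i).card

/-- The number of odd fixed points. -/
def oddFix {n : ℕ} (σ : Equiv.Perm (Fin (2 * n))) : ℕ :=
  (Finset.univ.filter fun i : Fin (2 * n) => Odd ((i : ℕ) + 1) ∧ σ i = i).card

/-! ### Labelled Schröder paths -/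

/-- The steps of a Schröder path: rise `(1, 1)`, fall `(1, -1)`, long level step `(2, 0)`. -/
inductive Step where
  | rise : Step
  | fall : Step
  | level : Step

/-- Horizontal extent of a step. -/
def Step.width : Step → ℕ
  | .rise => 1
  | .fall => 1
  | .level => 2

/-- Height after a step that starts at height `h`. (A fall never starts at height `0`, see
`IsLabelledFrom`.) -/
def Step.next (h : ℕ) : Step → ℕ
  | .rise => h + 1
  | .fall => h - 1
  | .level => h

/-- A sequence of steps, each with its label. -/
abbrev LabelledSteps := List (Step × ℕ)

/-- Total horizontal extent. -/
def pathLength (p : LabelledSteps) : ℕ := (p.map fun s => s.1.width).sum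

/-- Starting at height `h`, the steps stay at height `≥ 0` and end at height `0`, and the label of
each rise (fall, long level step) starting at height `k` lies in `A k` (`B k`, `C k`). -/
def IsLabelledFrom (A B C : ℕ → Set ℕ) : ℕ → LabelledSteps → Prop
  | h, [] => h = 0
  | h, (.rise, x) :: p => x ∈ A h ∧ IsLabelledFrom A B C (h + 1) p
  | h, (.fall, x) :: p => 1 ≤ h ∧ x ∈ B h ∧ IsLabelledFrom A B C (h - 1) p
  | h, (.level, x) :: p => x ∈ C h ∧ IsLabelledFrom A B C h p

/-- The `(A, B, C)`-labelled Schröder paths of length `m`. -/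
def labelledSchroderPaths (A B C : ℕ → Set ℕ) (m : ℕ) : Set LabelledSteps :=
  {p | pathLength p = m ∧ IsLabelledFrom A B C 0 p}

/-- Labels of rises: `{0, …, ⌈h/2⌉}`. -/
def labelA (h : ℕ) : Set ℕ := {x | x ≤ h ⌈/⌉ 2}

/-- Labels of falls: `{0, …, ⌈(h-1)/2⌉}` (used for `h ≥ 1` only). -/
def labelB (h : ℕ) : Set ℕ := {x | x ≤ (h - 1) ⌈/⌉ 2}

/-- Labels of long level steps: `{0}` at height `0` and none at positive height, so that long level
steps occur at height `0` only. -/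
def labelC (h : ℕ) : Set ℕ := {x | h = 0 ∧ x = 0}

/-- The labelled 0-Schröder paths of length `2n` that correspond to D-permutations of `[2n]`. -/
def DSPaths (n : ℕ) : Set LabelledSteps := labelledSchroderPaths labelA labelB labelC (2 * n)

/-- The largest height reached by a path starting at height `h`. -/
def maxHeightFrom : ℕ → LabelledSteps → ℕ
  | h, [] => h
  | h, s :: p => max h (maxHeightFrom (s.1.next h) p)

/-- The height of a path. -/
def pathHeight (p : LabelledSteps) : ℕ := maxHeightFrom 0 p

/-! ### The involution on labelled paths -/

/-- The label that replaces the label `x` of step number `i` when that step starts at height `h`. -/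
def compLabel (i h : ℕ) (x : ℕ) : Step → ℕ
  | .rise =>
      if Even i then (if x = h ⌈/⌉ 2 then x else h ⌈/⌉ 2 - 1 - x)
      else h ⌈/⌉ 2 - x
  | .fall =>
      if Even i then (h - 1) ⌈/⌉ 2 - x
      else (if x = (h - 1) ⌈/⌉ 2 then x else (h - 1) ⌈/⌉ 2 - 1 - x)
  | .level => x

/-- Replace all labels; the first step has number `i` and starts at height `h`. The number of a step
is one more than the abscissa at which it starts. -/
def complementFrom : ℕ → ℕ → LabelledSteps → LabelledSteps
  | _, _, [] => []
  | i, h, (s, x) :: p => (s, compLabel i h x s) :: complementFrom (i + s.width) (s.next h) p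

/-- The map `(ω, ξ) ↦ (ω, ξᶜ)`. -/
def complement (p : LabelledSteps) : LabelledSteps := complementFrom 1 0 p

/-! ### The first Deb–Sokal bijection -/

/-- Height at abscissa `k` of the almost-Dyck path of `σ`, whose step number `j` is a rise if
`σ⁻¹(j)` is even and a fall if `σ⁻¹(j)` is odd. -/
def almostDyckHeight {n : ℕ} (σ : Equiv.Perm (Fin (2 * n))) (k : ℕ) : ℤ :=
  ∑ j ∈ Finset.univ.filter (fun j : Fin (2 * n) => (j : ℕ) < k),
    if Even ((σ.symm j : ℕ) + 1) then 1 else -1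

/-- The label of the letter `i`: its number of (lower, resp. upper) nestings. -/
def nestLabel {n : ℕ} (σ : Equiv.Perm (Fin (2 * n))) (i : Fin (2 * n)) : ℕ :=
  if Even ((i : ℕ) + 1) then
    (Finset.univ.filter fun j : Fin (2 * n) => σ j < σ i ∧ σ i ≤ i ∧ i < j).card
  else
    (Finset.univ.filter fun j : Fin (2 * n) => j < i ∧ i ≤ σ i ∧ σ i < σ j).card

/-- The contribution of the letter `i` to the labelled 0-Schröder path. A fall from height `0` of the
almost-Dyck path and the rise from height `-1` after it are replaced by one long level step, with
label `0`; all other steps are kept and are labelled by `nestLabel`. -/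
def dsStep {n : ℕ} (σ : Equiv.Perm (Fin (2 * n))) (i : Fin (2 * n)) : Option (Step × ℕ) :=
  if almostDyckHeight σ i < 0 then none
  else if Even ((σ.symm i : ℕ) + 1) then some (.rise, nestLabel σ i)
  else if almostDyckHeight σ i = 0 then some (.level, 0)
  else some (.fall, nestLabel σ i)

/-- The Deb–Sokal map from permutations to labelled paths (relevant on D-permutations). -/
def dsMap {n : ℕ} (σ : Equiv.Perm (Fin (2 * n))) : LabelledSteps :=
  (List.finRange (2 * n)).filterMap (dsStep σ)

/-! ### The Genocchi–Corteel involution and its fixed points -/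

/-- The Genocchi–Corteel involution: `complement` conjugated by the bijection `dsMap` between
`DPerms n` and `DSPaths n`. -/
noncomputable def gc {n : ℕ} (σ : Equiv.Perm (Fin (2 * n))) : Equiv.Perm (Fin (2 * n)) :=
  Function.invFunOn dsMap (DPerms n) (complement (dsMap σ))

open Classical in
/-- The D-permutations of `[2n]` fixed by the Genocchi–Corteel involution. -/
noncomputable def gcFixed (n : ℕ) : Finset (Equiv.Perm (Fin (2 * n))) :=
  Finset.univ.filter fun σ => σ ∈ DPerms n ∧ gc σ = σ

/-- The variable `w_e`. -/
noncomputable def wₑ : MvPolynomial (Fin 2) ℤ := MvPolynomial.X 0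

/-- The variable `w_o`. -/
noncomputable def wₒ : MvPolynomial (Fin 2) ℤ := MvPolynomial.X 1

/-- The polynomial counting even and odd fixed points of the permutations in `gcFixed n`. -/
noncomputable def gcPoly (n : ℕ) : MvPolynomial (Fin 2) ℤ :=
  ∑ σ ∈ gcFixed n, wₑ ^ evenFix σ * wₒ ^ oddFix σ

/-- The inverse of a power series with constant coefficient `1`. -/
noncomputable def recip {R : Type*} [CommRing R] (f : R⟦X⟧) : R⟦X⟧ := PowerSeries.invOfUnit f 1

/-- `recip f` is the multiplicative inverse of `f` when `f` has constant coefficient `1`. -/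
theorem mul_recip {R : Type*} [CommRing R] (f : R⟦X⟧) (hf : PowerSeries.constantCoeff f = 1) :
    f * recip f = 1 :=
  PowerSeries.mul_invOfUnit f 1 (by simpa using hf)

end GenocchiCorteel

namespace GenocchiCorteel

/-! ### Codes of bijections between two finite sets of a linear order -/

/-! Split a D-permutation into its restrictions to the even and to the odd letters. The almost-Dyck
path records which values have an even preimage. Once it is known, the even part is a bijection `f`
between two known sets with `f p ≤ p`, the odd part one with `p ≤ f p`, and the nesting labels are
their Lehmer codes. A code is arbitrary subject to one inequality at each position (`code_lt`,
`exists_bijOn_of_code`, `eqOn_of_code_eq`). Since letters alternate in parity, the counts in it are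
a height, so it reads: twice the label is at most `h` at an odd letter, `h + 1` at an even letter
that is a rise and `h - 1` at one that is a fall (`IsDWord`). These are the bounds `⌈h/2⌉` and
`⌈(h-1)/2⌉`. They also show that the path never goes below `-1`, and that a fall from `0` and the
rise after it have label `0`, so contracting the pair to a long level step loses nothing
(`expand_injective`).

Equality in the code bound characterises fixed points: even ones are rises from odd height with the
largest label, odd ones are falls from even height with the largest label, and a long level step
hides one of each. Hence fixed points become a weight on paths (`pathWeight_dsMap`).

The complement is made of reflections of label intervals. Up to height `2` each interval that is
reflected is a single point; a rise from height `2` swaps the labels `0` and `1`. So its fixed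
points are the paths of height at most `2`, and decomposing these by their first step gives the
continued fraction (`mk_lowSum_mul`). -/

theorem exists_mem_card_lt_eq {α : Type*} [LinearOrder α] (V : Finset α) {k : ℕ}
    (hk : k < V.card) : ∃ v ∈ V, (V.filter (· < v)).card = k := by
  refine ⟨V.orderEmbOfFin rfl ⟨k, hk⟩, V.orderEmbOfFin_mem rfl _, ?_⟩
  have : V.filter (· < V.orderEmbOfFin rfl ⟨k, hk⟩) =
      (Finset.Iio (⟨k, hk⟩ : Fin V.card)).map (V.orderEmbOfFin rfl).toEmbedding := by
    ext u
    simp only [Finset.mem_filter, Finset.mem_map, Finset.mem_Iio]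
    constructor
    · rintro ⟨hu, hlt⟩
      have : u ∈ Set.range (V.orderEmbOfFin rfl) := by simpa using hu
      obtain ⟨i, rfl⟩ := this
      exact ⟨i, by simpa using hlt, rfl⟩
    · rintro ⟨i, hi, rfl⟩
      exact ⟨V.orderEmbOfFin_mem rfl _, by simpa using hi⟩
  rw [this, Finset.card_map, Fin.card_Iio]

theorem card_lt_injOn {α : Type*} [LinearOrder α] {V : Finset α} {u v : α} (hu : u ∈ V)
    (hv : v ∈ V) (h : (V.filter (· < u)).card = (V.filter (· < v)).card) : u = v := by
  have key : ∀ a b : α, a ∈ V → a < b →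
      (V.filter (· < a)).card < (V.filter (· < b)).card := by
    intro a b ha hab
    refine Finset.card_lt_card ⟨fun x hx => ?_, fun hs => ?_⟩
    · simp only [Finset.mem_filter] at hx ⊢
      exact ⟨hx.1, hx.2.trans hab⟩
    · have := hs (Finset.mem_filter.2 ⟨ha, hab⟩)
      simp at this
  rcases lt_trichotomy u v with hlt | heq | hgt
  · exact absurd h (key u v hu hlt).ne
  · exact heq
  · exact absurd h (key v u hv hgt).ne'

theorem card_filter_comp_of_bijOn {α : Type*} {P V : Finset α} {f : α → α}
    (hf : Set.BijOn f P V) (r : α → Prop) [DecidablePred r] :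
    (P.filter fun q => r (f q)).card = (V.filter r).card := by
  refine Finset.card_bij (fun q _ => f q) ?_ ?_ ?_
  · intro q hq
    simp only [Finset.mem_filter] at hq ⊢
    exact ⟨hf.mapsTo hq.1, hq.2⟩
  · intro a ha b hb hab
    exact hf.injOn (Finset.mem_filter.1 ha).1 (Finset.mem_filter.1 hb).1 hab
  · intro v hv
    obtain ⟨hv, hr⟩ := Finset.mem_filter.1 hv
    obtain ⟨q, hq, rfl⟩ := hf.surjOn hv
    exact ⟨q, Finset.mem_filter.2 ⟨hq, hr⟩, rfl⟩

/-- Greedy construction: the least position `a` takes the value with exactly `c a` smaller values in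
`V`. All of those go to later positions, so `a` gets code `c a`, and induction handles the rest. -/
theorem exists_bijOn_of_code {α : Type*} [LinearOrder α] (P V : Finset α) (c : α → ℕ)
    (hcard : P.card = V.card)
    (hc : ∀ p ∈ P, c p + (P.filter (· < p)).card < (V.filter (· ≤ p)).card) :
    ∃ f : α → α, Set.BijOn f P V ∧ ∀ p ∈ P, f p ≤ p ∧
      (P.filter fun q => p < q ∧ f q < f p).card = c p := by
  induction P using Finset.induction_on_min generalizing V with
  | empty =>
    have : V = ∅ := by simpa using hcard.symm
    subst this
    exact ⟨id, by simp, by simp⟩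
  | insert a s ha ih =>
    have has : a ∉ s := fun h => lt_irrefl _ (ha a h)
    have h0 := hc a (Finset.mem_insert_self a s)
    -- Choosing among the values `≤ a` secures `v ≤ a`; the rank of `v` in all of `V` is the same.
    obtain ⟨v, hv, hvc⟩ := exists_mem_card_lt_eq (V.filter (· ≤ a)) (lt_of_le_of_lt
      (Nat.le_add_right _ _) h0)
    obtain ⟨hvV, hva⟩ := Finset.mem_filter.1 hv
    have hvc' : (V.filter (· < v)).card = c a := by
      rw [← hvc, Finset.filter_filter]
      congr 1
      ext u
      simp only [Finset.mem_filter]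
      exact ⟨fun h => ⟨h.1, h.2.le.trans hva, h.2⟩, fun h => ⟨h.1, h.2.2⟩⟩
    have hcard' : s.card = (V.erase v).card := by
      rw [Finset.card_insert_of_notMem has] at hcard
      rw [Finset.card_erase_of_mem hvV]
      omega
    -- The bound at `p > a` survives: both of its counts drop by one, as `a < p` and `v ≤ a < p`.
    obtain ⟨g, hg, hgc⟩ := ih (V.erase v) hcard' (by
      intro p hp
      have h1 := hc p (Finset.mem_insert_of_mem hp)
      have hap := ha p hp
      rw [Finset.filter_insert, if_pos hap, Finset.card_insert_of_notMem (by simp [has])] at h1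
      rw [Finset.filter_erase, Finset.card_erase_of_mem (by simp [hvV, hva.trans hap.le])]
      omega)
    have hne : ∀ p ∈ s, p ≠ a := fun p hp h => has (h ▸ hp)
    have hfs : ∀ p ∈ s, Function.update g a v p = g p := fun p hp =>
      Function.update_of_ne (hne p hp) _ _
    have hbs : Set.BijOn (Function.update g a v) s (V.erase v) :=
      hg.congr fun p hp => (hfs p hp).symm
    have hb : Set.BijOn (Function.update g a v) (insert a s : Finset α) V := by
      have := hbs.insert (a := a) (by simp)
      rw [Function.update_self, ← Finset.coe_insert, ← Finset.coe_insert,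
        Finset.insert_erase hvV] at this
      exact this
    refine ⟨_, hb, ?_⟩
    intro p hp
    rcases Finset.mem_insert.1 hp with rfl | hps
    · rw [Function.update_self]
      refine ⟨hva, ?_⟩
      rw [← hvc', ← card_filter_comp_of_bijOn hb (· < v)]
      congr 1
      ext q
      simp only [Finset.mem_filter, and_congr_right_iff, Finset.mem_insert]
      rintro (rfl | hq)
      · simp
      · simp [ha q hq]
    · rw [hfs p hps]
      refine ⟨(hgc p hps).1, ?_⟩
      rw [← (hgc p hps).2, Finset.filter_insert, if_neg (by simp [(ha p hps).le])]
      congr 1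
      refine Finset.filter_congr fun q hq => ?_
      rw [hfs q hq]

/-- At the least position every other position is later, so its code is the rank of its value in `V`
and determines that value. Then remove the position and its value. -/
theorem eqOn_of_code_eq {α : Type*} [LinearOrder α] {P V : Finset α} {f g : α → α}
    (hf : Set.BijOn f P V) (hg : Set.BijOn g P V)
    (h : ∀ p ∈ P, (P.filter fun q => p < q ∧ f q < f p).card =
      (P.filter fun q => p < q ∧ g q < g p).card) : ∀ p ∈ P, f p = g p := by
  induction P using Finset.induction_on_min generalizing V with
  | empty => simp
  | insert a s ha ih =>
    have has : a ∉ s := fun h => lt_irrefl _ (ha a h)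
    have hmem : a ∈ insert a s := Finset.mem_insert_self a s
    have rank : ∀ k : α → α, Set.BijOn k (insert a s : Finset α) V →
        ((insert a s).filter fun q => a < q ∧ k q < k a).card = (V.filter (· < k a)).card := by
      intro k hk
      rw [← card_filter_comp_of_bijOn hk (· < k a)]
      congr 1
      ext q
      simp only [Finset.mem_filter, and_congr_right_iff, Finset.mem_insert]
      rintro (rfl | hq)
      · simp
      · simp [ha q hq]
    have hfa : f a = g a := by
      refine card_lt_injOn (hf.mapsTo hmem) (hg.mapsTo hmem) ?_
      rw [← rank f hf, ← rank g hg]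
      exact h a hmem
    have sub : ∀ k : α → α, Set.BijOn k (insert a s : Finset α) V →
        Set.BijOn k s (V.erase (k a)) := by
      intro k hk
      have := hk.sdiff_singleton (a := a) hmem
      simpa [has] using this
    have hlow : ∀ k : α → α, ∀ p ∈ s, ((insert a s).filter fun q => p < q ∧ k q < k p) =
        s.filter fun q => p < q ∧ k q < k p := by
      intro k p hp
      rw [Finset.filter_insert, if_neg (by simp [(ha p hp).le])]
    have hs := ih (sub f hf) (hfa ▸ sub g hg) (by
      intro p hp
      have := h p (Finset.mem_insert_of_mem hp)
      rwa [hlow f p hp, hlow g p hp] at this)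
    intro p hp
    rcases Finset.mem_insert.1 hp with rfl | hps
    · exact hfa
    · exact hs p hps

section
variable {α : Type*} [LinearOrder α] {P V : Finset α} {f : α → α} {p : α}

theorem code_add_card_lt (hp : p ∈ P) :
    (P.filter fun q => p < q ∧ f q < f p).card + (P.filter (· < p)).card + 1 =
      (P.filter fun q => q ≤ p ∨ f q < f p ∧ p < q).card := by
  have h1 : (P.filter fun q => q ≤ p ∨ f q < f p ∧ p < q) =
      insert p ((P.filter fun q => p < q ∧ f q < f p) ∪ P.filter (· < p)) := by
    ext q
    simp only [Finset.mem_filter, Finset.mem_insert, Finset.mem_union, le_iff_lt_or_eq]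
    constructor
    · tauto
    · rintro (rfl | h)
      · exact ⟨hp, Or.inl (Or.inr rfl)⟩
      · tauto
  rw [h1, Finset.card_insert_of_notMem (by simp), Finset.card_union_of_disjoint]
  rw [Finset.disjoint_filter]
  exact fun q _ h => h.1.not_gt

/-- The positions `q ≤ p`, and the later ones with `f q < f p`, all have values `≤ p`. -/
theorem code_lt (hf : Set.BijOn f P V) (hle : ∀ p ∈ P, f p ≤ p) (hp : p ∈ P) :
    (P.filter fun q => p < q ∧ f q < f p).card + (P.filter (· < p)).card <
      (V.filter (· ≤ p)).card := by
  rw [Nat.lt_iff_add_one_le, code_add_card_lt hp, ← card_filter_comp_of_bijOn hf (· ≤ p)]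
  refine Finset.card_le_card fun q hq => ?_
  simp only [Finset.mem_filter] at hq ⊢
  obtain ⟨hq, h | h⟩ := hq
  · exact ⟨hq, (hle q hq).trans h⟩
  · exact ⟨hq, h.1.le.trans (hle p hp)⟩

/-- In the case of equality every `q` with `f q ≤ p` satisfies `q ≤ p` or `f q < f p`. For the
preimage `q` of `p` the second contradicts `f p ≤ p`, and the first gives `q = p` because `p = f q ≤
q`. -/
theorem apply_eq_self_iff_code (hf : Set.BijOn f P V) (hle : ∀ p ∈ P, f p ≤ p) (hp : p ∈ P) :
    f p = p ↔ p ∈ V ∧ (P.filter fun q => p < q ∧ f q < f p).card + (P.filter (· < p)).card + 1 =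
      (V.filter (· ≤ p)).card := by
  rw [code_add_card_lt hp, ← card_filter_comp_of_bijOn hf (· ≤ p)]
  constructor
  · intro h
    refine ⟨by have := hf.mapsTo hp; rwa [h] at this, ?_⟩
    congr 1
    refine Finset.filter_congr fun q hq => ?_
    rw [h]
    constructor
    · rintro (h1 | h1)
      · exact (hle q hq).trans h1
      · exact h1.1.le
    · intro h1
      rcases le_or_gt q p with h2 | h2
      · exact Or.inl h2
      · refine Or.inr ⟨lt_of_le_of_ne h1 fun h3 => ?_, h2⟩
        exact h2.ne (hf.injOn hp hq (h.trans h3.symm))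
  · rintro ⟨hpV, hcard⟩
    have hsub : (P.filter fun q => q ≤ p ∨ f q < f p ∧ p < q) = P.filter fun q => f q ≤ p := by
      refine Finset.eq_of_subset_of_card_le (fun q hq => ?_) hcard.ge
      simp only [Finset.mem_filter] at hq ⊢
      obtain ⟨hq, h | h⟩ := hq
      · exact ⟨hq, (hle q hq).trans h⟩
      · exact ⟨hq, h.1.le.trans (hle p hp)⟩
    obtain ⟨q, hq, hqp⟩ := hf.surjOn hpV
    have : q ∈ P.filter fun q => f q ≤ p := Finset.mem_filter.2 ⟨hq, hqp.le⟩
    rw [← hsub] at this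
    rcases (Finset.mem_filter.1 this).2 with h | h
    · have := hle q hq
      rw [hqp] at this
      rwa [le_antisymm h this] at hqp
    · rw [hqp] at h
      exact absurd (hle p hp) h.1.not_ge

end

/-! The same for the reversed order. -/

theorem exists_bijOn_of_code_ge {α : Type*} [LinearOrder α] (P V : Finset α) (c : α → ℕ)
    (hcard : P.card = V.card)
    (hc : ∀ p ∈ P, c p + (P.filter (p < ·)).card < (V.filter (p ≤ ·)).card) :
    ∃ f : α → α, Set.BijOn f P V ∧ ∀ p ∈ P, p ≤ f p ∧
      (P.filter fun q => q < p ∧ f p < f q).card = c p :=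
  -- The order on `αᵒᵈ` unfolds to the reversed order of `α`, so the statements agree
  -- definitionally.
  exists_bijOn_of_code (α := αᵒᵈ) P V c hcard hc

theorem eqOn_of_code_ge_eq {α : Type*} [LinearOrder α] {P V : Finset α} {f g : α → α}
    (hf : Set.BijOn f P V) (hg : Set.BijOn g P V)
    (h : ∀ p ∈ P, (P.filter fun q => q < p ∧ f p < f q).card =
      (P.filter fun q => q < p ∧ g p < g q).card) : ∀ p ∈ P, f p = g p :=
  eqOn_of_code_eq (α := αᵒᵈ) hf hg h

theorem code_ge_lt {α : Type*} [LinearOrder α] {P V : Finset α} {f : α → α} {p : α}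
    (hf : Set.BijOn f P V) (hle : ∀ p ∈ P, p ≤ f p) (hp : p ∈ P) :
    (P.filter fun q => q < p ∧ f p < f q).card + (P.filter (p < ·)).card <
      (V.filter (p ≤ ·)).card :=
  code_lt (α := αᵒᵈ) hf hle hp

theorem apply_eq_self_iff_code_ge {α : Type*} [LinearOrder α] {P V : Finset α} {f : α → α} {p : α}
    (hf : Set.BijOn f P V) (hle : ∀ p ∈ P, p ≤ f p) (hp : p ∈ P) :
    f p = p ↔ p ∈ V ∧ (P.filter fun q => q < p ∧ f p < f q).card + (P.filter (p < ·)).card + 1 =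
      (V.filter (p ≤ ·)).card :=
  apply_eq_self_iff_code (α := αᵒᵈ) hf hle hp

/-! ### Counting below a given abscissa -/

/-- The number of `j < k` with `p j`. -/
def countBelow {N : ℕ} (p : Fin N → Prop) [DecidablePred p] (k : ℕ) : ℕ :=
  (Finset.univ.filter fun j : Fin N => (j : ℕ) < k ∧ p j).card

section
variable {N : ℕ} (p : Fin N → Prop) [DecidablePred p]

theorem countBelow_zero : countBelow p 0 = 0 := by simp [countBelow]

theorem countBelow_succ (k : Fin N) :
    countBelow p (k + 1) = countBelow p k + if p k then 1 else 0 := by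
  unfold countBelow
  have h : (Finset.univ.filter fun j : Fin N => (j : ℕ) < k + 1 ∧ p j) =
      (Finset.univ.filter fun j : Fin N => (j : ℕ) < k ∧ p j) ∪ ({k} : Finset (Fin N)).filter p := by
    ext j
    simp only [Finset.mem_filter, Finset.mem_univ, true_and, Finset.mem_union,
      Finset.mem_singleton, Fin.ext_iff]
    constructor
    · rintro ⟨h1, h2⟩
      rcases Nat.lt_succ_iff_lt_or_eq.1 h1 with h | h
      · exact Or.inl ⟨h, h2⟩
      · exact Or.inr ⟨h, h2⟩
    · rintro (⟨h1, h2⟩ | ⟨h1, h2⟩)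
      · exact ⟨by omega, h2⟩
      · exact ⟨by omega, h2⟩
  rw [h, Finset.card_union_of_disjoint, Finset.filter_singleton]
  · split_ifs <;> simp
  · rw [Finset.disjoint_left]
    intro j hj hj'
    simp only [Finset.mem_filter, Finset.mem_univ, true_and, Finset.mem_singleton] at hj hj'
    rw [hj'.1] at hj
    exact lt_irrefl _ hj.1

theorem countBelow_add_countBelow_not {k : ℕ} (hk : k ≤ N) :
    countBelow p k + countBelow (fun j => ¬ p j) k = k := by
  induction k with
  | zero => simp [countBelow_zero]
  | succ k ih =>
    have h1 := countBelow_succ p ⟨k, hk⟩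
    have h2 := countBelow_succ (fun j => ¬ p j) ⟨k, hk⟩
    have := ih (by omega)
    simp only at h1 h2
    split_ifs at h1 h2 <;> omega

theorem countBelow_eq_card : countBelow p N = (Finset.univ.filter p).card := by
  simp [countBelow]

/-- The odd letters are coded from the top, so their bounds involve counts above `k`; the additive
form avoids truncated subtraction. -/
theorem card_filter_le_add_countBelow (k : Fin N) :
    ((Finset.univ.filter p).filter (k ≤ ·)).card + countBelow p k = countBelow p N := by
  rw [countBelow_eq_card,
    ← Finset.card_filter_add_card_filter_not (s := Finset.univ.filter p) (k ≤ ·),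
    Nat.add_left_cancel_iff, countBelow, Finset.filter_filter]
  congr 1
  ext j
  simp only [Finset.mem_filter, Finset.mem_univ, true_and, not_le, Fin.lt_def]
  tauto

theorem card_filter_lt_add_countBelow (k : Fin N) :
    ((Finset.univ.filter p).filter (k < ·)).card + countBelow p (k + 1) = countBelow p N := by
  rw [countBelow_eq_card,
    ← Finset.card_filter_add_card_filter_not (s := Finset.univ.filter p) (k < ·),
    Nat.add_left_cancel_iff, countBelow, Finset.filter_filter]
  congr 1
  ext j
  simp only [Finset.mem_filter, Finset.mem_univ, true_and, not_lt, Fin.le_def, Nat.lt_succ_iff]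
  tauto

theorem card_filter_lt_eq_countBelow (k : Fin N) :
    ((Finset.univ.filter p).filter (· < k)).card = countBelow p k := by
  rw [countBelow, Finset.filter_filter]
  congr 1
  ext j
  simp [and_comm]

theorem card_filter_le_eq_countBelow (k : Fin N) :
    ((Finset.univ.filter p).filter (· ≤ k)).card = countBelow p (k + 1) := by
  rw [countBelow, Finset.filter_filter]
  congr 1
  ext j
  simp only [Finset.mem_filter, Finset.mem_univ, true_and, Fin.le_def, Nat.lt_succ_iff]
  tauto

theorem countBelow_even {k : ℕ} (hk : k ≤ N) :
    countBelow (fun j : Fin N => Even ((j : ℕ) + 1)) k = k / 2 := by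
  induction k with
  | zero => simp [countBelow_zero]
  | succ k ih =>
    have h1 := countBelow_succ (fun j : Fin N => Even ((j : ℕ) + 1)) ⟨k, hk⟩
    have := ih (by omega)
    simp only [Nat.even_iff] at h1 this ⊢
    split_ifs at h1 <;> omega

theorem countBelow_not_even {k : ℕ} (hk : k ≤ N) :
    countBelow (fun j : Fin N => ¬ Even ((j : ℕ) + 1)) k = (k + 1) / 2 := by
  have h1 := countBelow_even hk
  have h2 := countBelow_add_countBelow_not (fun j : Fin N => Even ((j : ℕ) + 1)) hk
  omega

end

/-! ### Words of rises and falls with labels -/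

/-- The height at abscissa `k` of the path whose step `j` is a rise if `(w j).1` and a fall
otherwise. -/
def wordHeight {N : ℕ} (w : Fin N → Bool × ℕ) (k : ℕ) : ℤ :=
  ∑ j ∈ Finset.univ.filter (fun j : Fin N => (j : ℕ) < k), if (w j).1 then 1 else -1

theorem wordHeight_eq_countBelow {N : ℕ} (w : Fin N → Bool × ℕ) (k : ℕ) :
    wordHeight w k = countBelow (fun j => (w j).1 = true) k -
      countBelow (fun j => ¬ (w j).1 = true) k := by
  rw [wordHeight, Finset.sum_ite, Finset.sum_const, Finset.sum_const, Finset.filter_filter,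
    Finset.filter_filter]
  simp only [countBelow, nsmul_eq_mul, mul_one, mul_neg]
  ring

theorem wordHeight_eq {N : ℕ} (w : Fin N → Bool × ℕ) {k : ℕ} (hk : k ≤ N) :
    wordHeight w k = 2 * countBelow (fun j => (w j).1 = true) k - k := by
  have := countBelow_add_countBelow_not (fun j => (w j).1 = true) hk
  rw [wordHeight_eq_countBelow]
  omega

theorem wordHeight_zero {N : ℕ} (w : Fin N → Bool × ℕ) : wordHeight w 0 = 0 := by
  simp [wordHeight]

theorem wordHeight_succ {N : ℕ} (w : Fin N → Bool × ℕ) (k : Fin N) :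
    wordHeight w (k + 1) = wordHeight w k + if (w k).1 then 1 else -1 := by
  rw [wordHeight_eq w k.2, wordHeight_eq w k.2.le, countBelow_succ]
  split_ifs <;> push_cast <;> ring

/-- The words of D-permutations: the final height is `0`, and every label is bounded in terms of the
height at which its step starts. -/
def IsDWord {n : ℕ} (w : Fin (2 * n) → Bool × ℕ) : Prop :=
  wordHeight w (2 * n) = 0 ∧ ∀ k : Fin (2 * n), 2 * ((w k).2 : ℤ) ≤
    wordHeight w k + if Even ((k : ℕ) + 1) then (if (w k).1 then 1 else -1) else 0

/-- The word of a permutation. -/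
def word {n : ℕ} (σ : Equiv.Perm (Fin (2 * n))) (k : Fin (2 * n)) : Bool × ℕ :=
  (decide (Even ((σ.symm k : ℕ) + 1)), nestLabel σ k)

/-! ### D-permutations and their words -/

section
variable {n : ℕ} {σ : Equiv.Perm (Fin (2 * n))}

theorem wordHeight_word (k : ℕ) : wordHeight (word σ) k = almostDyckHeight σ k := by
  simp [wordHeight, almostDyckHeight, word]

theorem bijOn_even (σ : Equiv.Perm (Fin (2 * n))) :
    Set.BijOn σ (Finset.univ.filter fun j : Fin (2 * n) => Even ((j : ℕ) + 1))
      (Finset.univ.filter fun j => (word σ j).1 = true) := by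
  refine ⟨fun j hj => ?_, σ.injective.injOn, fun j hj => ⟨σ.symm j, ?_, by simp⟩⟩
  · simpa [word] using hj
  · simpa [word] using hj

theorem bijOn_odd (σ : Equiv.Perm (Fin (2 * n))) :
    Set.BijOn σ (Finset.univ.filter fun j : Fin (2 * n) => ¬ Even ((j : ℕ) + 1))
      (Finset.univ.filter fun j => ¬ (word σ j).1 = true) := by
  refine ⟨fun j hj => ?_, σ.injective.injOn, fun j hj => ⟨σ.symm j, ?_, by simp⟩⟩
  · simpa [word] using hj
  · simpa [word] using hj

/-- Parity of `j` is automatic in a nesting: an odd `j` has `j ≤ σ j`, against `σ j < σ i ≤ i < j`.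
-/
theorem nestLabel_of_even (hσ : IsDPerm σ) {i : Fin (2 * n)} (hi : Even ((i : ℕ) + 1)) :
    ((Finset.univ.filter fun j : Fin (2 * n) => Even ((j : ℕ) + 1)).filter
      fun j => i < j ∧ σ j < σ i).card = nestLabel σ i := by
  rw [nestLabel, if_pos hi, Finset.filter_filter]
  congr 1
  ext j
  simp only [Finset.mem_filter, Finset.mem_univ, true_and]
  have h := (hσ i).2 hi
  constructor
  · rintro ⟨_, h1, h2⟩
    exact ⟨h2, h, h1⟩
  · rintro ⟨h1, h2, h3⟩
    refine ⟨?_, h3, h1⟩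
    by_contra hj
    exact absurd ((hσ j).1 (Nat.not_even_iff_odd.1 hj)) ((h1.trans_le h2).trans h3).not_ge

theorem nestLabel_of_not_even (hσ : IsDPerm σ) {i : Fin (2 * n)} (hi : ¬ Even ((i : ℕ) + 1)) :
    ((Finset.univ.filter fun j : Fin (2 * n) => ¬ Even ((j : ℕ) + 1)).filter
      fun j => j < i ∧ σ i < σ j).card = nestLabel σ i := by
  rw [nestLabel, if_neg hi, Finset.filter_filter]
  congr 1
  ext j
  simp only [Finset.mem_filter, Finset.mem_univ, true_and]
  have h := (hσ i).1 (Nat.not_even_iff_odd.1 hi)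
  constructor
  · rintro ⟨_, h1, h2⟩
    exact ⟨h1, h, h2⟩
  · rintro ⟨h1, h2, h3⟩
    exact ⟨fun hj => absurd ((hσ j).2 hj) ((h1.trans_le h2).trans h3).not_ge, h1, h3⟩

theorem le_of_mem_even (hσ : IsDPerm σ) : ∀ p ∈ (Finset.univ.filter fun j : Fin (2 * n) =>
    Even ((j : ℕ) + 1)), σ p ≤ p := fun p hp => (hσ p).2 (Finset.mem_filter.1 hp).2

theorem le_of_mem_odd (hσ : IsDPerm σ) : ∀ p ∈ (Finset.univ.filter fun j : Fin (2 * n) =>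
    ¬ Even ((j : ℕ) + 1)), p ≤ σ p :=
  fun p hp => (hσ p).1 (Nat.not_even_iff_odd.1 (Finset.mem_filter.1 hp).2)

theorem countBelow_rise_word (σ : Equiv.Perm (Fin (2 * n))) :
    countBelow (fun j => (word σ j).1 = true) (2 * n) = n := by
  rw [countBelow_eq_card, ← (Finset.card_bij (fun j _ => σ j) (fun j hj => (bijOn_even σ).mapsTo hj)
    (fun a _ b _ h => σ.injective h) fun j hj => ?_), ← countBelow_eq_card, countBelow_even le_rfl]
  · omega
  · obtain ⟨i, hi, rfl⟩ := (bijOn_even σ).surjOn hj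
    exact ⟨i, hi, rfl⟩

/-- The code bounds `code_lt` and `code_ge_lt`, with the counts of rises and falls expressed by the
height. -/
theorem isDWord_word (hσ : IsDPerm σ) : IsDWord (word σ) := by
  have hR := countBelow_rise_word σ
  have hF := countBelow_add_countBelow_not (fun j => (word σ j).1 = true) le_rfl
  refine ⟨by rw [wordHeight_eq _ le_rfl, hR]; push_cast; ring, fun k => ?_⟩
  have hht := wordHeight_eq (word σ) k.2.le
  have hk := countBelow_add_countBelow_not (fun j => (word σ j).1 = true) k.2.le
  by_cases hi : Even ((k : ℕ) + 1)
  · have h := code_lt (bijOn_even σ) (le_of_mem_even hσ)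
      (Finset.mem_filter.2 ⟨Finset.mem_univ k, hi⟩)
    rw [nestLabel_of_even hσ hi, card_filter_lt_eq_countBelow, card_filter_le_eq_countBelow,
      countBelow_even k.2.le, countBelow_succ] at h
    rw [if_pos hi, hht]
    rw [Nat.even_iff] at hi
    change 2 * (nestLabel σ k : ℤ) ≤ _
    split_ifs at h ⊢ <;> omega
  · have h := code_ge_lt (bijOn_odd σ) (le_of_mem_odd hσ)
      (Finset.mem_filter.2 ⟨Finset.mem_univ k, hi⟩)
    have h1 := card_filter_lt_add_countBelow (fun j : Fin (2 * n) => ¬ Even ((j : ℕ) + 1)) k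
    have h2 := card_filter_le_add_countBelow (fun j => ¬ (word σ j).1 = true) k
    rw [nestLabel_of_not_even hσ hi] at h
    rw [countBelow_not_even k.2, countBelow_not_even le_rfl] at h1
    rw [if_neg hi, hht]
    rw [Nat.even_iff] at hi
    change 2 * (nestLabel σ k : ℤ) ≤ _
    omega

theorem word_injOn {σ τ : Equiv.Perm (Fin (2 * n))} (hσ : IsDPerm σ) (hτ : IsDPerm τ)
    (h : word σ = word τ) : σ = τ := by
  ext1 i
  have hl : ∀ j, nestLabel σ j = nestLabel τ j := fun j => congrArg Prod.snd (congrFun h j)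
  by_cases hi : Even ((i : ℕ) + 1)
  · refine eqOn_of_code_eq (bijOn_even σ) (h ▸ bijOn_even τ) (fun p hp => ?_) i (by simpa using hi)
    have hp := (Finset.mem_filter.1 hp).2
    rw [nestLabel_of_even hσ hp, nestLabel_of_even hτ hp, hl]
  · refine eqOn_of_code_ge_eq (bijOn_odd σ) (h ▸ bijOn_odd τ) (fun p hp => ?_) i (by simpa using hi)
    have hp := (Finset.mem_filter.1 hp).2
    rw [nestLabel_of_not_even hσ hp, nestLabel_of_not_even hτ hp, hl]

theorem even_and_fixed_iff (hσ : IsDPerm σ) (k : Fin (2 * n)) (hk : Even ((k : ℕ) + 1)) :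
    σ k = k ↔ (word σ k).1 = true ∧ 2 * ((word σ k).2 : ℤ) = wordHeight (word σ) k + 1 := by
  rw [apply_eq_self_iff_code (bijOn_even σ) (le_of_mem_even hσ)
      (Finset.mem_filter.2 ⟨Finset.mem_univ k, hk⟩), nestLabel_of_even hσ hk,
      card_filter_lt_eq_countBelow, card_filter_le_eq_countBelow,
      countBelow_even k.2.le, countBelow_succ, wordHeight_eq _ k.2.le]
  simp only [Finset.mem_filter, Finset.mem_univ, true_and]
  refine and_congr_right fun h => ?_
  rw [if_pos h]
  rw [Nat.even_iff] at hk
  change _ ↔ 2 * (nestLabel σ k : ℤ) = _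
  omega

theorem odd_and_fixed_iff (hσ : IsDPerm σ) (k : Fin (2 * n)) (hk : ¬ Even ((k : ℕ) + 1)) :
    σ k = k ↔ (word σ k).1 = false ∧ 2 * ((word σ k).2 : ℤ) = wordHeight (word σ) k := by
  have hR := countBelow_rise_word σ
  have hF := countBelow_add_countBelow_not (fun j => (word σ j).1 = true) le_rfl
  have hk' := countBelow_add_countBelow_not (fun j => (word σ j).1 = true) k.2.le
  have h1 := card_filter_lt_add_countBelow (fun j : Fin (2 * n) => ¬ Even ((j : ℕ) + 1)) k
  have h2 := card_filter_le_add_countBelow (fun j => ¬ (word σ j).1 = true) k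
  rw [countBelow_not_even k.2, countBelow_not_even le_rfl] at h1
  rw [apply_eq_self_iff_code_ge (bijOn_odd σ) (le_of_mem_odd hσ)
      (Finset.mem_filter.2 ⟨Finset.mem_univ k, hk⟩), nestLabel_of_not_even hσ hk,
      wordHeight_eq _ k.2.le, Finset.mem_filter]
  refine and_congr (by simp) ?_
  rw [Nat.even_iff] at hk
  change _ ↔ 2 * (nestLabel σ k : ℤ) = _
  omega

/-- Even and odd letters are realised separately from their codes and glued. -/
theorem exists_word_eq {w : Fin (2 * n) → Bool × ℕ} (hw : IsDWord w) :
    ∃ σ : Equiv.Perm (Fin (2 * n)), IsDPerm σ ∧ word σ = w := by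
  obtain ⟨hw0, hw⟩ := hw
  rw [wordHeight_eq _ le_rfl] at hw0
  have hF := countBelow_add_countBelow_not (fun j => (w j).1 = true) le_rfl
  obtain ⟨f, hf, hfc⟩ := exists_bijOn_of_code
    (Finset.univ.filter fun j : Fin (2 * n) => Even ((j : ℕ) + 1))
    (Finset.univ.filter fun j => (w j).1 = true) (fun k => (w k).2)
    (by rw [← countBelow_eq_card, ← countBelow_eq_card, countBelow_even le_rfl]; omega)
    (fun k hk => by
      have hk := (Finset.mem_filter.1 hk).2
      have h := hw k
      rw [wordHeight_eq w k.2.le, if_pos hk] at h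
      rw [card_filter_lt_eq_countBelow, card_filter_le_eq_countBelow,
        countBelow_even k.2.le, countBelow_succ]
      rw [Nat.even_iff] at hk
      split_ifs at h ⊢ <;> omega)
  obtain ⟨g, hg, hgc⟩ := exists_bijOn_of_code_ge
    (Finset.univ.filter fun j : Fin (2 * n) => ¬ Even ((j : ℕ) + 1))
    (Finset.univ.filter fun j => ¬ (w j).1 = true) (fun k => (w k).2)
    (by rw [← countBelow_eq_card, ← countBelow_eq_card, countBelow_not_even le_rfl]; omega)
    (fun k hk => by
      have hk := (Finset.mem_filter.1 hk).2
      have h := hw k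
      have hk' := countBelow_add_countBelow_not (fun j => (w j).1 = true) k.2.le
      have h1 := card_filter_lt_add_countBelow (fun j : Fin (2 * n) => ¬ Even ((j : ℕ) + 1)) k
      have h2 := card_filter_le_add_countBelow (fun j => ¬ (w j).1 = true) k
      rw [countBelow_not_even k.2, countBelow_not_even le_rfl] at h1
      rw [wordHeight_eq w k.2.le, if_neg hk] at h
      rw [Nat.even_iff] at hk
      omega)
  have hfm : ∀ j : Fin (2 * n), Even ((j : ℕ) + 1) → (w (f j)).1 = true := fun j hj => by
    simpa using hf.mapsTo (x := j) (by simpa using hj)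
  have hgm : ∀ j : Fin (2 * n), ¬ Even ((j : ℕ) + 1) → ¬ (w (g j)).1 = true := fun j hj => by
    simpa using hg.mapsTo (x := j) (by simpa using hj)
  let s : Fin (2 * n) → Fin (2 * n) := fun j => if Even ((j : ℕ) + 1) then f j else g j
  have se : ∀ j : Fin (2 * n), Even ((j : ℕ) + 1) → s j = f j := fun j hj => if_pos hj
  have so : ∀ j : Fin (2 * n), ¬ Even ((j : ℕ) + 1) → s j = g j := fun j hj => if_neg hj
  -- Letters of different parity cannot collide: even letters go to rises, odd letters to falls.
  have hs : Function.Injective s := by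
    intro a b hab
    by_cases ha : Even ((a : ℕ) + 1) <;> by_cases hb : Even ((b : ℕ) + 1)
    · rw [se a ha, se b hb] at hab
      exact hf.injOn (by simpa using ha) (by simpa using hb) hab
    · rw [se a ha, so b hb] at hab
      exact absurd (hfm a ha) (hab ▸ hgm b hb)
    · rw [so a ha, se b hb] at hab
      exact absurd (hfm b hb) (hab ▸ hgm a ha)
    · rw [so a ha, so b hb] at hab
      exact hg.injOn (by simpa using ha) (by simpa using hb) hab
  let σ : Equiv.Perm (Fin (2 * n)) := Equiv.ofBijective s (Finite.injective_iff_bijective.1 hs)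
  have hσs : ∀ j, σ j = s j := fun j => rfl
  have hσ : IsDPerm σ := by
    refine fun i => ⟨fun hi => ?_, fun hi => ?_⟩
    · have hi := Nat.not_even_iff_odd.2 hi
      rw [hσs, so i hi]
      exact (hgc i (by simpa using hi)).1
    · rw [hσs, se i hi]
      exact (hfc i (by simpa using hi)).1
  refine ⟨σ, hσ, funext fun k => Prod.ext ?_ ?_⟩
  · obtain ⟨j, rfl⟩ := σ.surjective k
    simp only [word, Equiv.symm_apply_apply]
    rw [hσs]
    by_cases hj : Even ((j : ℕ) + 1)
    · rw [se j hj, hfm j hj]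
      simpa using hj
    · rw [so j hj, Bool.eq_false_iff.2 (hgm j hj)]
      simpa using hj
  · change nestLabel σ k = _
    by_cases hk : Even ((k : ℕ) + 1)
    · rw [← nestLabel_of_even hσ hk, ← (hfc k (by simpa using hk)).2]
      congr 1
      refine Finset.filter_congr fun j hj => ?_
      rw [hσs, hσs, se j (Finset.mem_filter.1 hj).2, se k hk]
    · rw [← nestLabel_of_not_even hσ hk, ← (hgc k (by simpa using hk)).2]
      congr 1
      refine Finset.filter_congr fun j hj => ?_
      rw [hσs, hσs, so j (Finset.mem_filter.1 hj).2, so k hk]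

end

/-! ### The label complement -/

theorem mem_labelA {h x : ℕ} : x ∈ labelA h ↔ x ≤ (h + 1) / 2 := by
  simp [labelA, Nat.ceilDiv_eq_add_pred_div]

theorem mem_labelB {h x : ℕ} (hh : 1 ≤ h) : x ∈ labelB h ↔ x ≤ h / 2 := by
  simp [labelB, Nat.ceilDiv_eq_add_pred_div, Nat.sub_add_cancel hh]

theorem pathLength_complementFrom (p : LabelledSteps) (i h : ℕ) :
    pathLength (complementFrom i h p) = pathLength p := by
  induction p generalizing i h with
  | nil => rfl
  | cons s p ih => simpa [complementFrom, pathLength] using ih _ _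

theorem isLabelledFrom_complementFrom (p : LabelledSteps) (i h : ℕ)
    (hp : IsLabelledFrom labelA labelB labelC h p) :
    IsLabelledFrom labelA labelB labelC h (complementFrom i h p) := by
  induction p generalizing i h with
  | nil => exact hp
  | cons s p ih =>
    obtain ⟨s, x⟩ := s
    cases s with
    | rise =>
      obtain ⟨hx, hp⟩ := hp
      refine ⟨?_, ih _ _ hp⟩
      rw [mem_labelA] at hx ⊢
      simp only [compLabel, Nat.ceilDiv_eq_add_pred_div]
      split_ifs <;> omega
    | fall =>
      obtain ⟨hh, hx, hp⟩ := hp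
      refine ⟨hh, ?_, ih _ _ hp⟩
      rw [mem_labelB hh] at hx ⊢
      simp only [compLabel, Nat.ceilDiv_eq_add_pred_div]
      split_ifs <;> omega
    | level => exact ⟨hp.1, ih _ _ hp.2⟩

/-- Step types, heights and step numbers are unchanged, so each label meets the same reflection
twice. -/
theorem complementFrom_complementFrom (p : LabelledSteps) (i h : ℕ)
    (hp : IsLabelledFrom labelA labelB labelC h p) :
    complementFrom i h (complementFrom i h p) = p := by
  induction p generalizing i h with
  | nil => rfl
  | cons s p ih =>
    obtain ⟨s, x⟩ := s
    cases s with
    | rise =>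
      obtain ⟨hx, hp⟩ := hp
      rw [mem_labelA] at hx
      simp only [complementFrom, compLabel, Nat.ceilDiv_eq_add_pred_div]
      refine congrArg₂ _ (Prod.ext rfl ?_) (ih _ _ hp)
      dsimp only
      split_ifs <;> omega
    | fall =>
      obtain ⟨hh, hx, hp⟩ := hp
      rw [mem_labelB hh] at hx
      simp only [complementFrom, compLabel, Nat.ceilDiv_eq_add_pred_div]
      refine congrArg₂ _ (Prod.ext rfl ?_) (ih _ _ hp)
      dsimp only
      split_ifs <;> omega
    | level => exact congrArg₂ _ rfl (ih _ _ hp.2)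

theorem le_maxHeightFrom (p : LabelledSteps) (h : ℕ) : h ≤ maxHeightFrom h p := by
  cases p with
  | nil => exact le_rfl
  | cons s p => exact le_max_left _ _

/-- `Odd (i + h)` ties the parity of the step number to that of the height. It selects, at heights
up to `2`, the branch of `compLabel` that fixes every admissible label, except for a rise from `2`.
-/
theorem complementFrom_eq_self_iff (p : LabelledSteps) (i h : ℕ)
    (hp : IsLabelledFrom labelA labelB labelC h p) (hi : Odd (i + h)) (hh : h ≤ 2) :
    complementFrom i h p = p ↔ maxHeightFrom h p ≤ 2 := by
  induction p generalizing i h with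
  | nil => simpa [complementFrom, maxHeightFrom] using hh
  | cons s p ih =>
    obtain ⟨s, x⟩ := s
    have hmax := le_maxHeightFrom p
    rw [Nat.odd_iff] at hi
    cases s with
    | rise =>
      obtain ⟨hx, hp⟩ := hp
      rw [mem_labelA] at hx
      simp only [complementFrom, maxHeightFrom, List.cons.injEq, Prod.mk.injEq, true_and,
        Step.next, Step.width, max_le_iff, hh, compLabel, Nat.ceilDiv_eq_add_pred_div,
        Nat.even_iff]
      -- Here `i` is odd and the label `x ≤ 1` becomes `1 - x ≠ x`, while the path reaches height
      -- `3`.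
      by_cases h2 : h = 2
      · subst h2
        have := hmax (2 + 1)
        refine iff_of_false (fun hc => ?_) (by omega)
        have := hc.1
        split_ifs at this <;> omega
      · rw [ih (i + 1) (h + 1) hp (by rw [Nat.odd_iff]; omega) (by omega)]
        refine and_iff_right ?_
        split_ifs <;> omega
    | fall =>
      obtain ⟨h1, hx, hp⟩ := hp
      rw [mem_labelB h1] at hx
      simp only [complementFrom, maxHeightFrom, List.cons.injEq, Prod.mk.injEq, true_and,
        Step.next, Step.width, max_le_iff, hh, compLabel, Nat.ceilDiv_eq_add_pred_div,
        Nat.even_iff]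
      rw [ih (i + 1) (h - 1) hp (by rw [Nat.odd_iff]; omega) (by omega)]
      refine and_iff_right ?_
      split_ifs <;> omega
    | level =>
      simp only [complementFrom, maxHeightFrom, List.cons.injEq, true_and,
        Step.next, Step.width, max_le_iff, hh, compLabel]
      exact ih (i + 2) h hp.2 (by rw [Nat.odd_iff]; omega) hh

theorem complement_mem_DSPaths {n : ℕ} {p : LabelledSteps} (hp : p ∈ DSPaths n) :
    complement p ∈ DSPaths n :=
  ⟨(pathLength_complementFrom p 1 0).trans hp.1, isLabelledFrom_complementFrom p 1 0 hp.2⟩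

theorem complement_complement {n : ℕ} {p : LabelledSteps} (hp : p ∈ DSPaths n) :
    complement (complement p) = p :=
  complementFrom_complementFrom p 1 0 hp.2

theorem complement_eq_self_iff {n : ℕ} {p : LabelledSteps} (hp : p ∈ DSPaths n) :
    complement p = p ↔ pathHeight p ≤ 2 :=
  complementFrom_eq_self_iff p 1 0 hp.2 (by decide) (by decide)

/-! ### Words and labelled paths -/

/-- Replace every long level step by a fall and a rise with labels `0`. -/
def expand : LabelledSteps → List (Bool × ℕ)
  | [] => []
  | (.rise, x) :: p => (true, x) :: expand p
  | (.fall, x) :: p => (false, x) :: expand p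
  | (.level, _) :: p => (false, 0) :: (true, 0) :: expand p

theorem length_expand (p : LabelledSteps) : (expand p).length = pathLength p := by
  induction p with
  | nil => rfl
  | cons s p ih =>
    obtain ⟨s, x⟩ := s
    cases s <;> simp only [expand, List.length_cons, ih, pathLength, List.map_cons, List.sum_cons,
      Step.width] <;> omega

/-- Only a fall and a long level step can be confused, but the former needs positive height and the
latter height `0`. -/
theorem expand_injective {p q : LabelledSteps} {h : ℕ}
    (hp : IsLabelledFrom labelA labelB labelC h p) (hq : IsLabelledFrom labelA labelB labelC h q)
    (hpq : expand p = expand q) : p = q := by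
  induction p generalizing q h with
  | nil =>
    cases q with
    | nil => rfl
    | cons s q =>
      obtain ⟨s, x⟩ := s
      cases s <;> simp [expand] at hpq
  | cons s p ih =>
    obtain ⟨s, x⟩ := s
    cases q with
    | nil => cases s <;> simp [expand] at hpq
    | cons t q =>
      obtain ⟨t, y⟩ := t
      cases s <;> cases t <;>
        simp only [expand, List.cons.injEq, Prod.mk.injEq, Bool.true_eq_false, Bool.false_eq_true,
          false_and, true_and] at hpq
      · rw [hpq.1, ih hp.2 hq.2 hpq.2]
      · rw [hpq.1, ih hp.2.2 hq.2.2 hpq.2]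
      · exact absurd hq.1.1 (Nat.pos_iff_ne_zero.1 hp.1)
      · exact absurd hp.1.1 (Nat.pos_iff_ne_zero.1 hq.1)
      · rw [hp.1.2, hq.1.2, ih hp.2 hq.2 hpq]

/-- The part of a word that starts at abscissa `a` and height `h` ends at height `0` and satisfies
the bounds of `IsDWord`. -/
def IsDWordFrom : ℕ → ℤ → List (Bool × ℕ) → Prop
  | _, h, [] => h = 0
  | a, h, (b, x) :: l => 2 * (x : ℤ) ≤ h + (if Even (a + 1) then (if b then 1 else -1) else 0) ∧
      IsDWordFrom (a + 1) (h + if b then 1 else -1) l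

theorem isDWordFrom_expand (p : LabelledSteps) (a h : ℕ)
    (hp : IsLabelledFrom labelA labelB labelC h p) (ha : Even (a + h)) :
    IsDWordFrom a h (expand p) := by
  induction p generalizing a h with
  | nil => exact congrArg Nat.cast hp
  | cons s p ih =>
    obtain ⟨s, x⟩ := s
    rw [Nat.even_iff] at ha
    cases s with
    | rise =>
      obtain ⟨hx, hp⟩ := hp
      rw [mem_labelA] at hx
      refine ⟨?_, by simpa using ih (a + 1) (h + 1) hp (by rw [Nat.even_iff]; omega)⟩
      simp only [if_true, Nat.even_iff]
      split_ifs <;> omega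
    | fall =>
      obtain ⟨h1, hx, hp⟩ := hp
      rw [mem_labelB h1] at hx
      refine ⟨?_, ?_⟩
      · simp only [Bool.false_eq_true, if_false, Nat.even_iff]
        split_ifs <;> omega
      · have := ih (a + 1) (h - 1) hp (by rw [Nat.even_iff]; omega)
        rwa [Nat.cast_sub h1] at this
    | level =>
      obtain ⟨⟨rfl, hx⟩, hp⟩ := hp
      refine ⟨?_, ?_, ih (a + 2) 0 hp (by rw [Nat.even_iff]; omega)⟩
      · rw [if_neg (by rw [Nat.even_iff]; omega)]
        simp
      · have : Even (a + 1 + 1) := by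
          rw [Nat.even_iff]
          omega
        simp [this]

theorem drop_finRange {N : ℕ} (k : Fin N) :
    (List.finRange N).drop k = k :: (List.finRange N).drop (k + 1) := by
  rw [List.drop_eq_getElem_cons (by simp)]
  simp

theorem isDWord_of_isDWordFrom {N : ℕ} {w : Fin N → Bool × ℕ} (m k : ℕ) (hk : k + m = N)
    (h : IsDWordFrom k (wordHeight w k) (((List.finRange N).drop k).map w)) :
    wordHeight w N = 0 ∧ ∀ j : Fin N, k ≤ j → 2 * ((w j).2 : ℤ) ≤
      wordHeight w j + if Even ((j : ℕ) + 1) then (if (w j).1 then 1 else -1) else 0 := by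
  induction m generalizing k with
  | zero =>
    obtain rfl : k = N := by omega
    rw [List.drop_of_length_le (by simp)] at h
    exact ⟨h, fun j hj => absurd j.2 hj.not_gt⟩
  | succ m ih =>
    have hkN : k < N := by omega
    rw [drop_finRange (⟨k, hkN⟩ : Fin N)] at h
    obtain ⟨h1, h2⟩ := h
    have := ih (k + 1) (by omega) (by
      rw [wordHeight_succ w ⟨k, hkN⟩]
      exact h2)
    refine ⟨this.1, fun j hj => ?_⟩
    rcases Nat.lt_or_eq_of_le hj with hj | hj
    · exact this.2 j hj
    · obtain rfl : (⟨k, hkN⟩ : Fin N) = j := Fin.ext hj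
      exact h1

theorem exists_isDWord_of_mem_DSPaths {n : ℕ} {p : LabelledSteps} (hp : p ∈ DSPaths n) :
    ∃ w : Fin (2 * n) → Bool × ℕ, IsDWord w ∧ (List.finRange (2 * n)).map w = expand p := by
  have hl : (expand p).length = 2 * n := (length_expand p).trans hp.1
  have hw : (List.finRange (2 * n)).map (fun k => (expand p).get (k.cast hl.symm)) = expand p := by
    refine List.ext_getElem (by simp [hl]) fun i h1 h2 => ?_
    simp
  refine ⟨_, ?_, hw⟩
  have := isDWord_of_isDWordFrom (2 * n) 0 (by omega)
    (w := fun k => (expand p).get (k.cast hl.symm)) (by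
      rw [wordHeight_zero, List.drop_zero, hw]
      exact isDWordFrom_expand p 0 0 hp.2 (by decide))
  exact ⟨this.1, fun k => this.2 k (Nat.zero_le _)⟩

/-- The contribution of the letter `k` of a word to the labelled path. -/
def wordStep {N : ℕ} (w : Fin N → Bool × ℕ) (k : Fin N) : Option (Step × ℕ) :=
  if wordHeight w k < 0 then none
  else if (w k).1 then some (.rise, (w k).2)
  else if wordHeight w k = 0 then some (.level, 0)
  else some (.fall, (w k).2)

theorem dsStep_eq_wordStep {n : ℕ} (σ : Equiv.Perm (Fin (2 * n))) :
    dsStep σ = wordStep (word σ) := by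
  funext k
  simp [dsStep, wordStep, wordHeight_word, word]

/-- The weight of a labelled path: a factor `x` for each rise from an odd height with largest
label, `y` for each fall from an even height with largest label, and `x * y` for each long level
step. -/
def pathWeight {M : Type*} [CommMonoid M] (x y : M) : ℕ → LabelledSteps → M
  | _, [] => 1
  | h, (.rise, l) :: p => (if Odd h ∧ l = (h + 1) / 2 then x else 1) * pathWeight x y (h + 1) p
  | h, (.fall, l) :: p => (if Even h ∧ l = h / 2 then y else 1) * pathWeight x y (h - 1) p
  | h, (.level, _) :: p => x * y * pathWeight x y h p

/-- The contribution of the letter `k` to the weight of a word. -/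
def wordWeight {M : Type*} [CommMonoid M] (x y : M) {N : ℕ} (w : Fin N → Bool × ℕ) (k : Fin N) :
    M :=
  if Even ((k : ℕ) + 1) then
    if (w k).1 = true ∧ 2 * ((w k).2 : ℤ) = wordHeight w k + 1 then x else 1
  else
    if (w k).1 = false ∧ 2 * ((w k).2 : ℤ) = wordHeight w k then y else 1

/-- Strong induction on the number `m` of remaining letters, since a long level step consumes two.
-/
theorem filterMap_wordStep {M : Type*} [CommMonoid M] (x y : M) {n : ℕ}
    {w : Fin (2 * n) → Bool × ℕ} (hw : IsDWord w) (m k : ℕ) (hk : k + m = 2 * n) (h : ℕ)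
    (hh : wordHeight w k = h) :
    IsLabelledFrom labelA labelB labelC h
        (((List.finRange (2 * n)).drop k).filterMap (wordStep w)) ∧
      expand (((List.finRange (2 * n)).drop k).filterMap (wordStep w)) =
        ((List.finRange (2 * n)).drop k).map w ∧
      pathWeight x y h (((List.finRange (2 * n)).drop k).filterMap (wordStep w)) =
        (((List.finRange (2 * n)).drop k).map (wordWeight x y w)).prod := by
  induction m using Nat.strong_induction_on generalizing k h with
  | _ m ih =>
  rcases Nat.eq_zero_or_pos m with rfl | hm
  · obtain rfl : k = 2 * n := by omega
    rw [List.drop_of_length_le (by simp)]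
    rw [hw.1] at hh
    exact ⟨by simpa [IsLabelledFrom] using hh.symm, rfl, rfl⟩
  have hkN : k < 2 * n := by omega
  have hpar := wordHeight_eq w hkN.le
  have hs := wordHeight_succ w ⟨k, hkN⟩
  have hb := hw.2 ⟨k, hkN⟩
  have hpos : ¬ wordHeight w k < 0 := by omega
  rw [drop_finRange (⟨k, hkN⟩ : Fin (2 * n))]
  simp only at hs hb
  rcases hwk : w ⟨k, hkN⟩ with ⟨b, c⟩
  rw [hwk] at hs hb
  simp only [hh, Nat.even_iff] at hs hb
  cases b with
  | true =>
    obtain ⟨i1, i2, i3⟩ := ih (m - 1) (by omega) (k + 1) (by omega) (h + 1) (by simpa using hs)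
    have e : wordStep w ⟨k, hkN⟩ = some (.rise, c) := by simp [wordStep, hpos, hwk]
    rw [List.filterMap_cons_some e]
    refine ⟨⟨?_, i1⟩, ?_, ?_⟩
    · rw [mem_labelA]
      simp only [if_true] at hb
      split_ifs at hb <;> omega
    · rw [List.map_cons, hwk, ← i2]
      rfl
    · rw [List.map_cons, List.prod_cons, ← i3]
      rw [pathWeight]
      congr 1
      simp only [wordWeight, hwk, hh, Nat.even_iff, Nat.odd_iff, true_and, Bool.true_eq_false,
        false_and, if_false]
      split_ifs <;> first | rfl | omega
  | false =>
    simp only [Bool.false_eq_true, if_false] at hs hb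
    rcases Nat.eq_zero_or_pos h with rfl | h0
    · have hc : c = 0 := by split_ifs at hb <;> omega
      have hk1 : k + 1 < 2 * n := by omega
      have hs1 := wordHeight_succ w ⟨k + 1, hk1⟩
      have hb1 := hw.2 ⟨k + 1, hk1⟩
      simp only at hs1 hb1
      rcases hwk1 : w ⟨k + 1, hk1⟩ with ⟨b1, c1⟩
      rw [hwk1] at hs1 hb1
      simp only [hs, Nat.even_iff] at hs1 hb1
      -- The height is now `-1` at an even letter; a fall would need `2 * c1 ≤ -2`.
      have hb1t : b1 = true := by
        cases b1 with
        | true => rfl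
        | false =>
          simp only [Bool.false_eq_true, if_false] at hb1
          split_ifs at hb1 <;> omega
      subst hb1t
      simp only [if_true] at hs1 hb1
      have hc1 : c1 = 0 := by split_ifs at hb1 <;> omega
      subst hc hc1
      obtain ⟨i1, i2, i3⟩ := ih (m - 2) (by omega) (k + 2) (by omega) 0 (by simpa using hs1)
      have e : wordStep w ⟨k, hkN⟩ = some (.level, 0) := by simp [wordStep, hwk, hh]
      have e1 : wordStep w ⟨k + 1, hk1⟩ = none := by simp [wordStep, hs]
      have d1 := drop_finRange (⟨k + 1, hk1⟩ : Fin (2 * n))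
      simp only at d1 ⊢
      rw [List.filterMap_cons_some e, d1, List.filterMap_cons_none e1]
      refine ⟨⟨⟨rfl, rfl⟩, i1⟩, ?_, ?_⟩
      · rw [List.map_cons, List.map_cons, hwk, hwk1]
        change _ = (false, 0) :: (true, 0) :: List.map w (List.drop (k + 2) _)
        rw [← i2]
        rfl
      · rw [List.map_cons, List.map_cons, List.prod_cons, List.prod_cons]
        change _ = _ * (_ * (List.map _ (List.drop (k + 2) _)).prod)
        rw [← i3]
        have w0 : wordWeight x y w ⟨k, hkN⟩ = y := by
          simp only [wordWeight, hwk, hh, Nat.even_iff]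
          rw [if_neg (by omega)]
          simp
        have w1 : wordWeight x y w ⟨k + 1, hk1⟩ = x := by
          simp only [wordWeight, hwk1, hs, Nat.even_iff]
          rw [if_pos (by omega)]
          simp
        rw [w0, w1, ← mul_assoc, mul_comm y x]
        rfl
    · obtain ⟨i1, i2, i3⟩ := ih (m - 1) (by omega) (k + 1) (by omega) (h - 1) (by
        rw [hs, Nat.cast_sub h0]; rfl)
      have e : wordStep w ⟨k, hkN⟩ = some (.fall, c) := by
        simp [wordStep, hwk, hh, h0.ne']
      rw [List.filterMap_cons_some e]
      refine ⟨⟨h0, ?_, i1⟩, ?_, ?_⟩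
      · rw [mem_labelB h0]
        split_ifs at hb <;> omega
      · rw [List.map_cons, hwk, ← i2]
        rfl
      · rw [List.map_cons, List.prod_cons, ← i3]
        rw [pathWeight]
        congr 1
        simp only [wordWeight, hwk, hh, Nat.even_iff, true_and, Bool.false_eq_true,
          false_and, if_false]
        split_ifs <;> first | rfl | omega

/-! ### The Deb–Sokal bijection and the Genocchi–Corteel involution -/

section
variable {n : ℕ} {σ : Equiv.Perm (Fin (2 * n))}

theorem dsMap_spec {M : Type*} [CommMonoid M] (x y : M) (hσ : IsDPerm σ) :
    IsLabelledFrom labelA labelB labelC 0 (dsMap σ) ∧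
      expand (dsMap σ) = (List.finRange (2 * n)).map (word σ) ∧
      pathWeight x y 0 (dsMap σ) =
        ((List.finRange (2 * n)).map (wordWeight x y (word σ))).prod := by
  have := filterMap_wordStep x y (isDWord_word hσ) (2 * n) 0 (by omega) 0
    (by simpa using wordHeight_zero _)
  rwa [List.drop_zero, ← dsStep_eq_wordStep] at this

theorem dsMap_mem_DSPaths (hσ : IsDPerm σ) : dsMap σ ∈ DSPaths n := by
  obtain ⟨h1, h2, _⟩ := dsMap_spec (1 : ℕ) 1 hσ
  exact ⟨by rw [← length_expand, h2]; simp, h1⟩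

theorem bijOn_dsMap (n : ℕ) : Set.BijOn (dsMap (n := n)) (DPerms n) (DSPaths n) := by
  refine ⟨fun σ hσ => dsMap_mem_DSPaths hσ, fun σ hσ τ hτ h => ?_, fun p hp => ?_⟩
  · have h1 := (dsMap_spec (1 : ℕ) 1 hσ).2.1
    have h2 := (dsMap_spec (1 : ℕ) 1 hτ).2.1
    rw [← h, h1] at h2
    exact word_injOn hσ hτ (funext fun k => List.map_inj_left.1 h2 k (List.mem_finRange k))
  · obtain ⟨w, hw, hwp⟩ := exists_isDWord_of_mem_DSPaths hp
    obtain ⟨σ, hσ, rfl⟩ := exists_word_eq hw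
    obtain ⟨h1, h2, _⟩ := dsMap_spec (1 : ℕ) 1 hσ
    exact ⟨σ, hσ, expand_injective h1 hp.2 (h2.trans hwp)⟩

/-- The complement of an image is again in the image, so `Function.invFunOn` never takes its default
value here. -/
theorem dsMap_gc (hσ : IsDPerm σ) : gc σ ∈ DPerms n ∧ dsMap (gc σ) = complement (dsMap σ) := by
  have h := (bijOn_dsMap n).surjOn (complement_mem_DSPaths (dsMap_mem_DSPaths hσ))
  exact ⟨Function.invFunOn_mem h, Function.invFunOn_eq h⟩

theorem gc_gc (hσ : IsDPerm σ) : gc (gc σ) = σ := by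
  obtain ⟨h1, h2⟩ := dsMap_gc hσ
  obtain ⟨h3, h4⟩ := dsMap_gc h1
  refine (bijOn_dsMap n).injOn h3 hσ ?_
  rw [h4, h2, complement_complement (dsMap_mem_DSPaths hσ)]

theorem gc_eq_self_iff (hσ : IsDPerm σ) : gc σ = σ ↔ pathHeight (dsMap σ) ≤ 2 := by
  obtain ⟨h1, h2⟩ := dsMap_gc hσ
  rw [← complement_eq_self_iff (dsMap_mem_DSPaths hσ), ← h2]
  exact ⟨fun h => by rw [h], fun h => (bijOn_dsMap n).injOn h1 hσ h⟩

theorem pathWeight_dsMap {M : Type*} [CommMonoid M] (x y : M) (hσ : IsDPerm σ) :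
    pathWeight x y 0 (dsMap σ) = x ^ evenFix σ * y ^ oddFix σ := by
  rw [(dsMap_spec x y hσ).2.2]
  have h : ∀ k, wordWeight x y (word σ) k = (if Even ((k : ℕ) + 1) ∧ σ k = k then x else 1) *
      if Odd ((k : ℕ) + 1) ∧ σ k = k then y else 1 := by
    intro k
    by_cases hk : Even ((k : ℕ) + 1)
    · simp only [wordWeight, if_true, ← even_and_fixed_iff hσ k hk, hk, true_and,
        Nat.not_odd_iff_even.2 hk, false_and, if_false, mul_one]
    · simp only [wordWeight, ← odd_and_fixed_iff hσ k hk, hk, true_and,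
        Nat.not_even_iff_odd.1 hk, false_and, if_false, one_mul]
  rw [← List.ofFn_eq_map, List.prod_ofFn, Finset.prod_congr rfl fun k _ => h k,
    Finset.prod_mul_distrib, Finset.prod_ite, Finset.prod_ite]
  simp [evenFix, oddFix]

end

/-! ### Paths of height at most two -/

/-- The labelled paths of length `m` from height `h ≤ 2` to height `0` that do not go above
height `2`. -/
def lowPaths : ℕ → ℕ → List LabelledSteps
  | 0, 0 => [[]]
  | 1, 0 => []
  | m + 2, 0 => (lowPaths (m + 1) 1).map ((.rise, 0) :: ·) ++ (lowPaths m 0).map ((.level, 0) :: ·)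
  | m + 1, 1 => (lowPaths m 0).map ((.fall, 0) :: ·) ++ ((lowPaths m 2).map ((.rise, 0) :: ·) ++
      (lowPaths m 2).map ((.rise, 1) :: ·))
  | m + 1, 2 => (lowPaths m 1).map ((.fall, 0) :: ·) ++ (lowPaths m 1).map ((.fall, 1) :: ·)
  | _, _ => []

theorem mem_map_cons_cons {s t : Step × ℕ} {l : List LabelledSteps} {p : LabelledSteps} :
    t :: p ∈ l.map (s :: ·) ↔ t = s ∧ p ∈ l := by
  simp only [List.mem_map, List.cons.injEq]
  constructor
  · rintro ⟨q, hq, rfl, rfl⟩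
    exact ⟨rfl, hq⟩
  · rintro ⟨rfl, hp⟩
    exact ⟨p, hp, rfl, rfl⟩

theorem pathLength_cons (s : Step × ℕ) (p : LabelledSteps) :
    pathLength (s :: p) = s.1.width + pathLength p := rfl

/-- Excludes paths too short to return to height `0`, such as a single rise in the case of `lowPaths
1 0`. -/
theorem le_pathLength (p : LabelledSteps) (h : ℕ)
    (hp : IsLabelledFrom labelA labelB labelC h p) : h ≤ pathLength p := by
  induction p generalizing h with
  | nil => exact le_of_eq hp
  | cons s p ih =>
    obtain ⟨s, x⟩ := s
    rw [pathLength_cons]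
    cases s with
    | rise => exact (Nat.le_succ h).trans ((ih _ hp.2).trans (Nat.le_add_left _ _))
    | fall =>
      have := ih _ hp.2.2
      simp only [Step.width]
      omega
    | level => exact (ih _ hp.2).trans (Nat.le_add_left _ _)

theorem mem_lowPaths (m h : ℕ) (p : LabelledSteps) : p ∈ lowPaths m h ↔
    pathLength p = m ∧ IsLabelledFrom labelA labelB labelC h p ∧ maxHeightFrom h p ≤ 2 := by
  induction p generalizing m h with
  | nil =>
    have hm : maxHeightFrom h [] = h := rfl
    have hl : pathLength [] = 0 := rfl
    have hi : IsLabelledFrom labelA labelB labelC h [] ↔ h = 0 := Iff.rfl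
    rw [hm, hl, hi]
    rcases m with _ | _ | m <;> rcases h with _ | _ | _ | h <;> simp [lowPaths]
  | cons s p ih =>
    obtain ⟨s, x⟩ := s
    have hmax := le_maxHeightFrom p
    have hlen := le_pathLength p 1
    rw [pathLength_cons]
    fun_cases lowPaths m h
    -- The catch-all case knows only that the earlier patterns fail; these instances supply the
    -- predecessors of `m` that refute them.
    case' case6 h3 h4 h5 =>
      have h3 := h3 (m - 2)
      have h4 := h4 (m - 1)
      have h5 := h5 (m - 1)
    all_goals
      simp only [List.mem_append, mem_map_cons_cons, ih, List.not_mem_nil, List.mem_singleton,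
        Prod.mk.injEq]
      cases s <;>
      simp only [IsLabelledFrom, maxHeightFrom, Step.next, Step.width, labelA, labelB, labelC,
        Set.mem_ofPred_eq, max_le_iff, Nat.ceilDiv_eq_add_pred_div] <;>
      grind

theorem nodup_map_cons {s : Step × ℕ} {l : List LabelledSteps} (hl : l.Nodup) :
    (l.map (s :: ·)).Nodup := hl.map (List.cons_injective)

theorem disjoint_map_cons {s t : Step × ℕ} (hst : s ≠ t) (l l' : List LabelledSteps) :
    List.Disjoint (l.map (s :: ·)) (l'.map (t :: ·)) := by
  intro p hp hp'
  obtain ⟨q, _, rfl⟩ := List.mem_map.1 hp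
  exact hst (mem_map_cons_cons.1 hp').1

theorem nodup_lowPaths (m h : ℕ) : (lowPaths m h).Nodup := by
  fun_induction lowPaths m h with
  | case1 => simp
  | case2 => simp
  | case3 m ih1 ih2 =>
    exact (nodup_map_cons ih1).append (nodup_map_cons ih2) (disjoint_map_cons (by simp) _ _)
  | case4 m ih1 ih2 =>
    refine (nodup_map_cons ih1).append ((nodup_map_cons ih2).append (nodup_map_cons ih2)
      (disjoint_map_cons (by simp) _ _)) (List.disjoint_append_right.2
        ⟨disjoint_map_cons (by simp) _ _, disjoint_map_cons (by simp) _ _⟩)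
  | case5 m ih =>
    exact (nodup_map_cons ih).append (nodup_map_cons ih) (disjoint_map_cons (by simp) _ _)
  | case6 => simp

/-- The generating polynomial of `lowPaths m h`. -/
def lowSum {R : Type*} [CommRing R] (x y : R) (m h : ℕ) : R :=
  ((lowPaths m h).map (pathWeight x y h)).sum

/-! ### The continued fraction -/

section
variable {R : Type*} [CommRing R] (x y : R)

theorem lowSum_zero_zero : lowSum x y 0 0 = 1 := by simp [lowSum, lowPaths, pathWeight]

theorem lowSum_zero_two : lowSum x y 0 2 = 0 := by simp [lowSum, lowPaths]

theorem lowSum_add_two_zero (m : ℕ) :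
    lowSum x y (m + 2) 0 = lowSum x y (m + 1) 1 + x * y * lowSum x y m 0 := by
  simp [lowSum, lowPaths, pathWeight, Function.comp_def, List.sum_map_mul_left]
  ring

theorem lowSum_succ_one (m : ℕ) :
    lowSum x y (m + 1) 1 = lowSum x y m 0 + (1 + x) * lowSum x y m 2 := by
  simp [lowSum, lowPaths, pathWeight, Function.comp_def, List.sum_map_mul_left, add_mul]

theorem lowSum_succ_two (m : ℕ) : lowSum x y (m + 1) 2 = (1 + y) * lowSum x y m 1 := by
  simp [lowSum, lowPaths, pathWeight, Function.comp_def, List.sum_map_mul_left, add_mul]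

theorem mk_lowSum_mul :
    (PowerSeries.mk fun n => lowSum x y (2 * n) 0) *
      (1 - PowerSeries.C (x * y) * PowerSeries.X - PowerSeries.X *
        recip (1 - PowerSeries.C ((1 + x) * (1 + y)) * PowerSeries.X)) = 1 := by
  set A : R⟦X⟧ := PowerSeries.mk fun n => lowSum x y (2 * n) 0 with hA
  set B : R⟦X⟧ := PowerSeries.mk fun n => lowSum x y (2 * n + 1) 1 with hB
  have h1 : A = 1 + PowerSeries.X * (PowerSeries.C (x * y) * A + B) := by
    ext n
    rcases n with _ | n
    · simp [hA, lowSum_zero_zero]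
    · rw [map_add, PowerSeries.coeff_succ_X_mul, map_add, PowerSeries.coeff_C_mul, hA, hB]
      simp only [PowerSeries.coeff_mk, PowerSeries.coeff_one]
      rw [show 2 * (n + 1) = 2 * n + 2 by ring, lowSum_add_two_zero, if_neg (by omega)]
      ring
  -- From height `1`, a path falls to `0` or makes an excursion `1 → 2 → 1`, whose label choices
  -- contribute `(1 + x) * (1 + y)`.
  have h2 : B = A + PowerSeries.X * (PowerSeries.C ((1 + x) * (1 + y)) * B) := by
    ext n
    rcases n with _ | n
    · simp [hA, hB, lowSum_zero_two, lowSum_succ_one]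
    · rw [map_add, PowerSeries.coeff_succ_X_mul, PowerSeries.coeff_C_mul, hA, hB]
      simp only [PowerSeries.coeff_mk]
      rw [lowSum_succ_one, show 2 * (n + 1) = 2 * n + 1 + 1 by ring, lowSum_succ_two]
      ring
  have h3 := mul_recip (1 - PowerSeries.C ((1 + x) * (1 + y)) * PowerSeries.X) (by simp)
  set r := recip (1 - PowerSeries.C ((1 + x) * (1 + y)) * PowerSeries.X)
  have h4 : B = A * r := by
    linear_combination (-B) * h3 + r * h2
  rw [h4] at h1
  linear_combination h1

end

theorem gcPoly_eq_lowSum (n : ℕ) : gcPoly n = lowSum wₑ wₒ (2 * n) 0 := by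
  classical
  rw [lowSum, ← List.sum_toFinset _ (nodup_lowPaths _ _), gcPoly]
  have hfix : ∀ σ : Equiv.Perm (Fin (2 * n)), σ ∈ gcFixed n ↔ IsDPerm σ ∧ gc σ = σ := fun σ => by
    rw [gcFixed, Finset.mem_filter]
    exact and_iff_right (Finset.mem_univ σ)
  refine Finset.sum_bij (fun σ _ => dsMap σ) (fun σ hσ => ?_) (fun σ hσ τ hτ h => ?_)
    (fun p hp => ?_) (fun σ hσ => ?_)
  · rw [hfix] at hσ
    have h := dsMap_mem_DSPaths hσ.1
    rw [List.mem_toFinset, mem_lowPaths]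
    exact ⟨h.1, h.2, (gc_eq_self_iff hσ.1).1 hσ.2⟩
  · exact (bijOn_dsMap n).injOn ((hfix σ).1 hσ).1 ((hfix τ).1 hτ).1 h
  · rw [List.mem_toFinset, mem_lowPaths] at hp
    obtain ⟨σ, hσ, rfl⟩ := (bijOn_dsMap n).surjOn (show p ∈ DSPaths n from ⟨hp.1, hp.2.1⟩)
    exact ⟨σ, (hfix σ).2 ⟨hσ, (gc_eq_self_iff hσ).2 hp.2.2⟩, rfl⟩
  · exact (pathWeight_dsMap _ _ ((hfix σ).1 hσ).1).symm

theorem eq_recip_of_mul_eq_one {R : Type*} [CommRing R] {f g : R⟦X⟧} (h : g * f = 1)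
    (hf : PowerSeries.constantCoeff f = 1) : g = recip f := by
  rw [← mul_one g, ← mul_recip f hf, ← mul_assoc, h, one_mul]

end GenocchiCorteel

theorem mainTheorem5 :
    -- the Deb–Sokal map is a bijection from D-permutations onto the labelled 0-Schröder paths
    (∀ n : ℕ, Set.BijOn (GenocchiCorteel.dsMap (n := n))
      (GenocchiCorteel.DPerms n) (GenocchiCorteel.DSPaths n)) ∧
    -- the label complement is an involution on the labelled 0-Schröder paths, and its fixed points
    -- are the paths of height at most two
    (∀ n : ℕ, ∀ p ∈ GenocchiCorteel.DSPaths n,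
      GenocchiCorteel.complement p ∈ GenocchiCorteel.DSPaths n ∧
      GenocchiCorteel.complement (GenocchiCorteel.complement p) = p ∧
      (GenocchiCorteel.complement p = p ↔ GenocchiCorteel.pathHeight p ≤ 2)) ∧
    -- the Genocchi–Corteel map is an involution on D-permutations
    (∀ n : ℕ, ∀ σ ∈ GenocchiCorteel.DPerms n,
      GenocchiCorteel.gc σ ∈ GenocchiCorteel.DPerms n ∧
      GenocchiCorteel.gc (GenocchiCorteel.gc σ) = σ) ∧
    -- the generating function of the fixed points
    PowerSeries.mk GenocchiCorteel.gcPoly =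
      GenocchiCorteel.recip
        (1 - PowerSeries.C (GenocchiCorteel.wₑ * GenocchiCorteel.wₒ) * PowerSeries.X
          - PowerSeries.X * GenocchiCorteel.recip
              (1 - PowerSeries.C ((1 + GenocchiCorteel.wₑ) * (1 + GenocchiCorteel.wₒ)) *
                PowerSeries.X)) := by
  refine ⟨GenocchiCorteel.bijOn_dsMap, fun n p hp =>
    ⟨GenocchiCorteel.complement_mem_DSPaths hp, GenocchiCorteel.complement_complement hp,
      GenocchiCorteel.complement_eq_self_iff hp⟩,
    fun n σ hσ => ⟨(GenocchiCorteel.dsMap_gc hσ).1, GenocchiCorteel.gc_gc hσ⟩, ?_⟩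
  rw [show GenocchiCorteel.gcPoly = _ from funext GenocchiCorteel.gcPoly_eq_lowSum]
  exact GenocchiCorteel.eq_recip_of_mul_eq_one (GenocchiCorteel.mk_lowSum_mul _ _) (by simp)
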